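/- Let $K$ be prefix-free Kolmogorov complexity of binary strings (with respect to any fixed optimal prefix-free machine). For a binary string $\sigma$ of length $n\ge 1$ put $\dim(\sigma)=K(\sigma)/n$, and for an infinite binary sequence $X$ let $\dim(X)=\liminf_{n}\dim(X{\restriction} n)$ be its effective Hausdorff dimension, where $X{\restriction}n$ is the $n$-bit prefix of $X$. For infinite binary sequences $X,Y$ let \[ d(X,Y)=\limsup_{n\to\infty}\frac{\#\{k<n : X(k)\ne Y(k)\}}{n}, \] and let $H(p)=-(p\log_2 p+(1-p)\log_2(1-p))$ on $[0,1]$ (with $0\log_2 0=0$) be the binary entropy function. Then for all infinite binary sequences $X$ and $Y$, \[ |\dim(Y)-\dim(X)|\le H\bigl(\min\{d(X,Y),\tfrac12\}\bigr). \] That is, $|\dim(Y)-\dim(X)|\le H(d(X,Y))$ whenever $d(X,Y)\le \tfrac12$, and $|\dim(Y)-\dim(X)|\le 1=H(\tfrac12)$ otherwise. -/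

import Mathlib

namespace EffectiveDimension

/-! ### Prefix-free Kolmogorov complexity -/

/-- A prefix-free machine: a partial computable map from binary strings to binary strings such that
no string in its domain is a proper prefix of another string in its domain. -/
structure IsPrefixFreeMachine (M : List Bool →. List Bool) : Prop where
  partrec : Partrec M
  prefixFree : ∀ p q : List Bool, (M p).Dom → (M q).Dom → p <+: q → p = q

/-- An optimal (universal) prefix-free machine: a prefix-free machine that simulates every
prefix-free machine with at most a constant increase in the length of programs. -/
structure IsOptimalPrefixFreeMachine (U : List Bool →. List Bool) : Prop
    extends IsPrefixFreeMachine U where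
  optimal : ∀ M : List Bool →. List Bool, IsPrefixFreeMachine M →
    ∃ c : ℕ, ∀ p σ : List Bool, σ ∈ M p → ∃ q : List Bool, σ ∈ U q ∧ q.length ≤ p.length + c

section Existence

open Nat.Partrec (Code)

/-- Program `c` halts within `k` steps on `q`, which differs from `p` and is comparable with it. -/
def Clash (k : ℕ) (c : Code) (p q : List Bool) : Prop :=
  q ≠ p ∧ q.take p.length = p.take q.length ∧ (Code.evaln k c (Encodable.encode q)).isSome = true

/-- No clash with an input of code below `k`. -/
def Ok (k : ℕ) (c : Code) (p : List Bool) : Prop :=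
  ∀ m < k, ¬ Clash k c p ((Encodable.decode m : Option (List Bool)).getD p)

theorem primrec_evaln_str {α : Type*} [Primcodable α] {k : α → ℕ} {c : α → Code}
    {p : α → List Bool} (hk : Primrec k) (hc : Primrec c) (hp : Primrec p) :
    Primrec fun a => Code.evaln (k a) (c a) (Encodable.encode (p a)) :=
  Code.primrec_evaln.comp ((hk.pair hc).pair (Primrec.encode.comp hp))

theorem primrec_clash :
    PrimrecPred fun a : (ℕ × Code × List Bool) × List Bool =>
      Clash a.1.1 a.1.2.1 a.1.2.2 a.2 := by
  have hk : Primrec fun a : (ℕ × Code × List Bool) × List Bool => a.1.1 :=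
    Primrec.fst.comp Primrec.fst
  have hc : Primrec fun a : (ℕ × Code × List Bool) × List Bool => a.1.2.1 :=
    Primrec.fst.comp (Primrec.snd.comp Primrec.fst)
  have hp : Primrec fun a : (ℕ × Code × List Bool) × List Bool => a.1.2.2 :=
    Primrec.snd.comp (Primrec.snd.comp Primrec.fst)
  have hq : Primrec fun a : (ℕ × Code × List Bool) × List Bool => a.2 := Primrec.snd
  refine PrimrecPred.and (PrimrecPred.not (Primrec.eq.comp hq hp)) (PrimrecPred.and
    (Primrec.eq.comp (Primrec.list_take.comp (Primrec.list_length.comp hp) hq)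
      (Primrec.list_take.comp (Primrec.list_length.comp hq) hp)) ?_)
  exact Primrec.eq.comp (Primrec.option_isSome.comp (primrec_evaln_str hk hc hq))
    (Primrec.const true)

theorem primrec_ok :
    PrimrecPred fun a : ℕ × Code × List Bool => Ok a.1 a.2.1 a.2.2 := by
  have h : PrimrecRel fun (m : ℕ) (a : ℕ × Code × List Bool) =>
      ¬ Clash a.1 a.2.1 a.2.2 ((Encodable.decode m : Option (List Bool)).getD a.2.2) := by
    refine PrimrecPred.not (primrec_clash.comp (Primrec.pair Primrec.snd ?_))
    exact Primrec.option_getD.comp (Primrec.decode.comp Primrec.fst)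
      (Primrec.snd.comp (Primrec.snd.comp Primrec.snd))
  exact (h.forall_mem_list.comp (Primrec.list_range.comp Primrec.fst) Primrec.id).of_eq
    fun a => by simp [Ok]

open Classical in
/-- Run program `c` on `p` until it halts; keep the result only if no other input comparable with
`p` has been seen to halt by then. -/
noncomputable def filtered (c : Code) (p : List Bool) : Part (List Bool) :=
  (Nat.rfind fun k => Part.some (Code.evaln k c (Encodable.encode p)).isSome).bind fun k =>
    ((if Ok k c p then
        (Code.evaln k c (Encodable.encode p)).bind fun y => (Encodable.decode y : Option (List Bool))
      else none : Option (List Bool)) : Part (List Bool))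

open Classical in
theorem partrec_filtered :
    Partrec fun a : Code × List Bool => filtered a.1 a.2 := by
  refine Partrec.bind (Partrec.rfind ?_) ?_
  · refine Computable.partrec ?_
    exact (Primrec.option_isSome.comp (primrec_evaln_str Primrec.snd
      (Primrec.fst.comp Primrec.fst) (Primrec.snd.comp Primrec.fst))).to_comp
  · refine Computable.ofOption (Primrec.to_comp ?_)
    refine Primrec.ite (primrec_ok.comp (Primrec.snd.pair Primrec.fst)) ?_ (Primrec.const none)
    exact Primrec.option_bind (primrec_evaln_str Primrec.snd
      (Primrec.fst.comp Primrec.fst) (Primrec.snd.comp Primrec.fst))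
      (Primrec.decode.comp Primrec.snd)

theorem filtered_dom {c : Code} {p : List Bool} (h : (filtered c p).Dom) :
    ∃ k, (Code.evaln k c (Encodable.encode p)).isSome = true ∧ Ok k c p := by
  obtain ⟨y, hy⟩ := Part.dom_iff_mem.1 h
  obtain ⟨k, hk, hy⟩ := Part.mem_bind_iff.1 hy
  refine ⟨k, ?_, ?_⟩
  · simpa using (Nat.rfind_spec hk)
  · by_contra hn
    simp [hn] at hy

theorem evaln_isSome_mono {k l : ℕ} (h : k ≤ l) {c : Code} {n : ℕ}
    (hs : (Code.evaln k c n).isSome = true) : (Code.evaln l c n).isSome = true := by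
  obtain ⟨x, hx⟩ := Option.isSome_iff_exists.1 hs
  exact Option.isSome_iff_exists.2 ⟨x, Code.evaln_mono h hx⟩

theorem not_clash_of_ok {k : ℕ} {c : Code} {p q : List Bool} (h : Ok k c p) :
    ¬ Clash k c p q := by
  intro hc
  obtain ⟨x, hx⟩ := Option.isSome_iff_exists.1 hc.2.2
  have := h _ (Code.evaln_bound hx)
  simp only [Encodable.encodek, Option.getD_some] at this
  exact this hc

theorem filtered_prefixFree {c : Code} {p q : List Bool} (hp : (filtered c p).Dom)
    (hq : (filtered c q).Dom) (h : p <+: q) : p = q := by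
  obtain ⟨k, hk, hkp⟩ := filtered_dom hp
  obtain ⟨l, hl, hlq⟩ := filtered_dom hq
  have ht : p.take q.length = q.take p.length := by
    rw [← List.prefix_iff_eq_take.1 h, List.take_of_length_le h.length_le]
  by_contra hne
  rcases le_total k l with hkl | hkl
  · exact not_clash_of_ok hlq ⟨hne, ht, evaln_isSome_mono hkl hk⟩
  · exact not_clash_of_ok hkp ⟨fun h => hne h.symm, ht.symm, evaln_isSome_mono hkl hl⟩

theorem mem_filtered {M : List Bool →. List Bool} (hM : IsPrefixFreeMachine M) {c : Code}
    (hc : ∀ p, Code.eval c (Encodable.encode p) = (M p).map Encodable.encode)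
    {p σ : List Bool} (h : σ ∈ M p) : σ ∈ filtered c p := by
  have key : ∀ k q, (Code.evaln k c (Encodable.encode q)).isSome = true → (M q).Dom := by
    intro k q hs
    obtain ⟨x, hx⟩ := Option.isSome_iff_exists.1 hs
    have := Code.evaln_sound hx
    rw [hc] at this
    exact (Part.dom_iff_mem.2 ⟨x, this⟩ : ((M q).map Encodable.encode).Dom)
  have hev : Encodable.encode σ ∈ Code.eval c (Encodable.encode p) := by
    rw [hc]; exact Part.mem_map _ h
  obtain ⟨k₀, hk₀⟩ := Code.evaln_complete.1 hev
  have hd : (Nat.rfind fun k => Part.some (Code.evaln k c (Encodable.encode p)).isSome).Dom :=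
    Nat.rfind_dom.2 ⟨k₀, by
      rw [Option.isSome_iff_exists.2 ⟨_, hk₀⟩]; exact Part.mem_some _, fun _ => trivial⟩
  obtain ⟨k, hk⟩ := Part.dom_iff_mem.1 hd
  have hs : (Code.evaln k c (Encodable.encode p)).isSome = true := by
    simpa using (Nat.rfind_spec hk)
  have hok : Ok k c p := by
    intro m _ hcl
    obtain ⟨hne, ht, hq⟩ := hcl
    have hMq := key _ _ hq
    have hMp : (M p).Dom := Part.dom_iff_mem.2 ⟨σ, h⟩
    rcases le_total p.length ((Encodable.decode m : Option (List Bool)).getD p).length with hl | hl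
    · rw [List.take_of_length_le hl] at ht
      exact hne (hM.prefixFree _ _ hMp hMq (List.prefix_iff_eq_take.2 ht.symm)).symm
    · rw [List.take_of_length_le hl] at ht
      exact hne (hM.prefixFree _ _ hMq hMp (List.prefix_iff_eq_take.2 ht))
  refine Part.mem_bind_iff.2 ⟨k, hk, ?_⟩
  obtain ⟨x, hx⟩ := Option.isSome_iff_exists.1 hs
  have hxe : x = Encodable.encode σ := Part.mem_unique (Code.evaln_sound hx) hev
  simp [hok, hx, hxe]

/-- The machine that on input `0 ^ e 1 p` runs the filtered version of the `e`-th program on `p`. -/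
noncomputable def standardMachine (r : List Bool) : Part (List Bool) :=
  ((if r.findIdx id < r.length then
      some (Denumerable.ofNat Code (r.findIdx id), r.drop (r.findIdx id + 1)) else none :
    Option (Code × List Bool)) : Part (Code × List Bool)).bind fun a => filtered a.1 a.2

theorem isPrefixFreeMachine_standardMachine : IsPrefixFreeMachine standardMachine where
  partrec := by
    have hi : Primrec fun r : List Bool => r.findIdx id :=
      Primrec.list_findIdx Primrec.id (p := fun _ b => id b) Primrec.snd
    refine Partrec.bind (Computable.ofOption (Primrec.to_comp ?_))
      (partrec_filtered.comp Computable.snd)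
    refine Primrec.ite (Primrec.nat_lt.comp hi Primrec.list_length) ?_ (Primrec.const none)
    exact Primrec.option_some.comp (((Primrec.ofNat Code).comp hi).pair
      (Primrec.list_drop.comp (Primrec.succ.comp hi) Primrec.id))
  prefixFree := by
    intro p q hp hq h
    have aux : ∀ r, (standardMachine r).Dom → r.findIdx id < r.length ∧
        (filtered (Denumerable.ofNat Code (r.findIdx id)) (r.drop (r.findIdx id + 1))).Dom := by
      intro r hr
      by_cases hlt : r.findIdx id < r.length
      · simp only [standardMachine, hlt, if_true] at hr
        exact ⟨hlt, by simpa using hr⟩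
      · simp [standardMachine, hlt] at hr
    obtain ⟨hp1, hp2⟩ := aux p hp
    obtain ⟨hq1, hq2⟩ := aux q hq
    obtain ⟨t, rfl⟩ := h
    have hidx : (p ++ t).findIdx id = p.findIdx id := by
      rw [List.findIdx_append, if_pos hp1]
    rw [hidx, List.drop_append_of_le_length hp1] at hq2
    have := filtered_prefixFree hp2 hq2 (List.prefix_append _ _)
    have ht : t = [] := by simpa using this
    simp [ht]

/-- An optimal prefix-free machine exists. -/
theorem exists_isOptimalPrefixFreeMachine :
    ∃ U : List Bool →. List Bool, IsOptimalPrefixFreeMachine U := by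
  refine ⟨standardMachine, isPrefixFreeMachine_standardMachine, ?_⟩
  intro M hM
  obtain ⟨c, hc⟩ := Code.exists_code.1 hM.partrec
  have hc' : ∀ p, Code.eval c (Encodable.encode p) = (M p).map Encodable.encode := by
    intro p
    rw [hc]
    simp
  refine ⟨Encodable.encode c + 1, fun p σ h => ?_⟩
  refine ⟨List.replicate (Encodable.encode c) false ++ true :: p, ?_, by simp; omega⟩
  have hidx : (List.replicate (Encodable.encode c) false ++ true :: p).findIdx id =
      Encodable.encode c := by
    rw [List.findIdx_append]
    have : ¬ (List.replicate (Encodable.encode c) false).findIdx id <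
        (List.replicate (Encodable.encode c) false).length := by
      rw [List.findIdx_lt_length]
      simp
    rw [if_neg this]
    simp [List.findIdx_cons]
  have hlt : Encodable.encode c <
      (List.replicate (Encodable.encode c) false ++ true :: p).length := by simp
  have hdrop : (List.replicate (Encodable.encode c) false ++ true :: p).drop
      (Encodable.encode c + 1) = p := by
    rw [List.drop_append]
    simp
  have := mem_filtered hM hc' h
  simp only [standardMachine, hidx, hlt, if_true, hdrop]
  simpa using this

end Existence

/-- The prefix-free Kolmogorov complexity `K(σ)` with respect to the machine `U`: the length of a
shortest `U`-program for `σ`. (For an optimal `U` every `σ` has a program.) -/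
noncomputable def prefixComplexity (U : List Bool →. List Bool) (σ : List Bool) : ℕ :=
  sInf {n : ℕ | ∃ p : List Bool, σ ∈ U p ∧ p.length = n}

/-! ### Effective dimension, distance and entropy -/

/-- The `n`-bit prefix of an infinite binary sequence. -/
def restrict (X : ℕ → Bool) (n : ℕ) : Fin n → Bool := fun i => X i

/-- The dimension `K(σ) / n` of a binary string `σ` of length `n`. -/
noncomputable def strDim (U : List Bool →. List Bool) {n : ℕ} (σ : Fin n → Bool) : ℝ :=
  (prefixComplexity U (List.ofFn σ) : ℝ) / n

/-- The effective Hausdorff dimension `liminf K(X↾n) / n` of an infinite binary sequence. -/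
noncomputable def effDim (U : List Bool →. List Bool) (X : ℕ → Bool) : ℝ :=
  Filter.liminf (fun n : ℕ => strDim U (restrict X n)) Filter.atTop

/-- The normalised Hamming distance of two binary strings of length `n`. -/
noncomputable def strDist {n : ℕ} (σ τ : Fin n → Bool) : ℝ :=
  (hammingDist σ τ : ℝ) / n

/-- The Besicovitch distance of two infinite binary sequences. -/
noncomputable def besicovitchDist (X Y : ℕ → Bool) : ℝ :=
  Filter.limsup (fun n : ℕ => strDist (restrict X n) (restrict Y n)) Filter.atTop

/-- The binary entropy function, with logarithms to base `2` (and `0 * log 0 = 0`). -/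
noncomputable def entropy (p : ℝ) : ℝ :=
  -(p * Real.logb 2 p + (1 - p) * Real.logb 2 (1 - p))

end EffectiveDimension

/-!
The distance is symmetric, so it suffices to bound `dim(Y)` above by `dim(X)` plus the entropy term.
Let `d` be the distance of `X` and `Y`.

Suppose `d < 1 / 2` and take rationals `q` in `(d, 1 / 2)` and `h > H(q)`. For all large `n`, the
prefix `Y↾n` lies in the Hamming ball of radius `q n` about `X↾n`. Such a ball has at most
`2 ^ (n H(q))` members (`card_hammingBall_le`), so a member of it is determined by its centre and
about `h n` further bits. This gives `K(Y↾n) ≤ K(X↾n) + h n + O(1)`. Divide by `n`, take the lower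
limit (`effDim_le_add`), and let `q → d` and `h → H(d)`. If `d ≥ 1 / 2`, the same argument with the
set of all `2 ^ n` strings as the ball gives the bound `1 = H(1 / 2)`.

The complexity bound is `prefixComplexity_le_of_mem_list`. Its machine reads a program `p` for a
string `σ`, followed by a block of bits selecting a member of a finite list computed from `σ`. The
length of the block is computable from `σ`, and the given machine is prefix-free, so the
concatenation needs no delimiter: there is at most one way to split an input, and it is found by
dovetailing over all splittings. Fixing the rationals `q` and `h` in advance makes them part of
the machine, so that nothing but the block itself has to be appended to `p`.
-/

namespace EffectiveDimension

open Nat.Partrec (Code)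

/-! ### Enumerating binary strings -/

/-- The list of all binary strings of length `n`. -/
def boolStrings : ℕ → List (List Bool)
  | 0 => [[]]
  | n + 1 => (boolStrings n).flatMap fun s => [false :: s, true :: s]

theorem mem_boolStrings {n : ℕ} {s : List Bool} : s ∈ boolStrings n ↔ s.length = n := by
  induction n generalizing s with
  | zero => simp [boolStrings]
  | succ n ih =>
    cases s with
    | nil => simp [boolStrings]
    | cons b s => cases b <;> simp [boolStrings, ih]

theorem nodup_boolStrings (n : ℕ) : (boolStrings n).Nodup := by
  induction n with
  | zero => simp [boolStrings]
  | succ n ih =>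
    refine List.nodup_flatMap.2 ⟨fun s _ => by simp, ih.imp fun h => ?_⟩
    simp [Function.onFun, List.Disjoint, h]

theorem length_boolStrings (n : ℕ) : (boolStrings n).length = 2 ^ n := by
  induction n with
  | zero => simp [boolStrings]
  | succ n ih => simp [boolStrings, List.length_flatMap, ih, pow_succ]

theorem primrec_boolStrings : Primrec boolStrings := by
  have h : Primrec₂ fun (_ : ℕ) (l : List (List Bool)) =>
      l.flatMap fun s => [false :: s, true :: s] := by
    refine Primrec.list_flatMap Primrec.snd ?_
    exact Primrec.list_cons.comp (Primrec.list_cons.comp (Primrec.const false) Primrec.snd)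
      (Primrec.list_cons.comp (Primrec.list_cons.comp (Primrec.const true) Primrec.snd)
        (Primrec.const []))
  refine (Primrec.nat_rec₁ [[]] h).of_eq fun n => ?_
  induction n with
  | zero => rfl
  | succ n ih => simp [boolStrings, ← ih]

/-! ### Prefix-free complexity with respect to an optimal machine -/

section Complexity

variable {U : List Bool →. List Bool}

theorem prefixComplexity_le {p σ : List Bool} (h : σ ∈ U p) :
    prefixComplexity U σ ≤ p.length :=
  Nat.sInf_le ⟨p, h, rfl⟩

/-- The machine that reads `1 ^ n 0 w` with `w` of length `n` and outputs `w`. -/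
def unaryMachine (r : List Bool) : Part (List Bool) :=
  ((if r.length = 2 * r.findIdx (!·) + 1 then some (r.drop (r.findIdx (!·) + 1)) else none :
    Option (List Bool)) : Part (List Bool))

theorem unaryMachine_dom {r : List Bool} :
    (unaryMachine r).Dom ↔ r.length = 2 * r.findIdx (!·) + 1 := by
  unfold unaryMachine
  split_ifs with h <;> simp [h]

theorem isPrefixFreeMachine_unaryMachine : IsPrefixFreeMachine unaryMachine where
  partrec := by
    have hi : Primrec fun r : List Bool => r.findIdx (!·) :=
      Primrec.list_findIdx Primrec.id (Primrec.not.comp Primrec.snd)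
    refine Computable.ofOption (Primrec.to_comp ?_)
    refine Primrec.ite (Primrec.eq.comp Primrec.list_length
      (Primrec.succ.comp (Primrec.nat_mul.comp (Primrec.const 2) hi))) ?_ (Primrec.const none)
    exact Primrec.option_some.comp (Primrec.list_drop.comp (Primrec.succ.comp hi) Primrec.id)
  prefixFree := by
    rintro p _ hp hq ⟨t, rfl⟩
    rw [unaryMachine_dom] at hp hq
    rw [List.findIdx_append, if_pos (by omega), List.length_append] at hq
    have : t = [] := List.eq_nil_of_length_eq_zero (by omega)
    simp [this]

theorem mem_unaryMachine (w : List Bool) :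
    w ∈ unaryMachine (List.replicate w.length true ++ false :: w) := by
  have h : (List.replicate w.length true ++ false :: w).findIdx (!·) = w.length := by
    rw [List.findIdx_append, if_neg (by rw [List.findIdx_lt_length]; simp)]
    simp [List.findIdx_cons]
  simp [unaryMachine, h, List.drop_append, two_mul, add_assoc]

theorem IsOptimalPrefixFreeMachine.exists_program (hU : IsOptimalPrefixFreeMachine U)
    (σ : List Bool) : ∃ p, σ ∈ U p ∧ p.length = prefixComplexity U σ := by
  obtain ⟨c, hc⟩ := hU.optimal _ isPrefixFreeMachine_unaryMachine
  obtain ⟨q, hq, -⟩ := hc _ _ (mem_unaryMachine σ)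
  exact Nat.sInf_mem (s := {n : ℕ | ∃ p : List Bool, σ ∈ U p ∧ p.length = n}) ⟨_, q, hq, rfl⟩

/-- The complexity of a string is at most linear in its length; this makes the `liminf` that
defines the effective dimension a genuine one. -/
theorem IsOptimalPrefixFreeMachine.exists_prefixComplexity_le (hU : IsOptimalPrefixFreeMachine U) :
    ∃ c : ℕ, ∀ σ, prefixComplexity U σ ≤ 2 * σ.length + c := by
  obtain ⟨c, hc⟩ := hU.optimal _ isPrefixFreeMachine_unaryMachine
  refine ⟨c + 1, fun σ => ?_⟩
  obtain ⟨q, hq, hl⟩ := hc _ _ (mem_unaryMachine σ)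
  have := prefixComplexity_le hq
  simp at hl
  omega

/-! ### Describing a member of a finite list attached to a string -/

variable {L : List Bool → List (List Bool)} {k : List Bool → ℕ} {c : Code}

/-- One stage of the search performed by `listMachine`: `m` codes a splitting position `i` and a
time bound `t`. If `c` halts within `t` steps on the first `i` bits of `r` with output `σ`, and if
exactly `k σ` bits remain, these bits select a member of `L σ`, by their position in
`boolStrings (k σ)`. -/
def listStep (L : List Bool → List (List Bool)) (k : List Bool → ℕ) (c : Code) (r : List Bool)
    (m : ℕ) : Option (List Bool) :=
  ((Code.evaln m.unpair.2 c (Encodable.encode (r.take m.unpair.1))).bind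
      fun x => (Encodable.decode x : Option (List Bool))).bind fun σ =>
    if r.length = m.unpair.1 + k σ then
      (L σ)[(boolStrings (k σ)).idxOf (r.drop m.unpair.1)]? else none

/-- The machine that reads a program for some string `σ` followed by `k σ` bits that select a
member of the list `L σ`, and outputs that member. -/
def listMachine (L : List Bool → List (List Bool)) (k : List Bool → ℕ) (c : Code)
    (r : List Bool) : Part (List Bool) :=
  Nat.rfindOpt (listStep L k c r)

theorem partrec_listMachine (hL : Primrec L) (hk : Primrec k) (c : Code) :
    Partrec (listMachine L k c) := by
  refine Partrec.rfindOpt (Primrec.to_comp ?_)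
  have hr : Primrec fun a : List Bool × ℕ => a.1 := Primrec.fst
  have hi : Primrec fun a : List Bool × ℕ => a.2.unpair.1 :=
    Primrec.fst.comp (Primrec.unpair.comp Primrec.snd)
  have ht : Primrec fun a : List Bool × ℕ => a.2.unpair.2 :=
    Primrec.snd.comp (Primrec.unpair.comp Primrec.snd)
  refine Primrec.option_bind (Primrec.option_bind
    (primrec_evaln_str ht (Primrec.const c) (Primrec.list_take.comp hi hr))
    (Primrec.decode.comp Primrec.snd)) ?_
  have hk' := hk.comp (Primrec.snd (α := List Bool × ℕ) (β := List Bool))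
  refine Primrec.ite (Primrec.eq.comp (Primrec.list_length.comp (hr.comp Primrec.fst))
    (Primrec.nat_add.comp (hi.comp Primrec.fst) hk')) ?_ (Primrec.const none)
  have hidx := Primrec.list_idxOf.comp
    (Primrec.list_drop.comp (hi.comp Primrec.fst) (hr.comp Primrec.fst))
    (primrec_boolStrings.comp hk')
  refine Primrec.list_getElem?.comp (hL.comp Primrec.snd) ?_
  -- The two sides use different but equal Boolean equality tests on strings.
  convert hidx

theorem exists_mem_listStep_iff
    (hc : ∀ p, Code.eval c (Encodable.encode p) = (U p).map Encodable.encode)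
    {r τ : List Bool} : (∃ m, τ ∈ listStep L k c r m) ↔
      ∃ p w σ, r = p ++ w ∧ σ ∈ U p ∧ w.length = k σ ∧
        (L σ)[(boolStrings (k σ)).idxOf w]? = some τ := by
  constructor
  · rintro ⟨m, hm⟩
    obtain ⟨σ, hσ, hm⟩ := Option.bind_eq_some_iff.1 hm
    obtain ⟨x, hx, hxσ⟩ := Option.bind_eq_some_iff.1 hσ
    have hx := Code.evaln_sound hx
    rw [hc] at hx
    obtain ⟨y, hy, rfl⟩ := (Part.mem_map_iff _).1 hx
    obtain rfl : y = σ := by simpa using hxσ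
    split_ifs at hm with hlen
    exact ⟨_, _, y, (List.take_append_drop m.unpair.1 r).symm, hy, by simp [hlen], hm⟩
  · rintro ⟨p, w, σ, rfl, hσ, hw, hτ⟩
    have : Encodable.encode σ ∈ Code.eval c (Encodable.encode p) := by
      rw [hc]; exact Part.mem_map _ hσ
    obtain ⟨t, ht⟩ := Code.evaln_complete.1 this
    refine ⟨Nat.pair p.length t, ?_⟩
    rw [Option.mem_def] at ht
    simp [listStep, ht, hw, hτ]

theorem isPrefixFreeMachine_listMachine (hU : IsPrefixFreeMachine U)
    (hc : ∀ p, Code.eval c (Encodable.encode p) = (U p).map Encodable.encode)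
    (hL : Primrec L) (hk : Primrec k) : IsPrefixFreeMachine (listMachine L k c) where
  partrec := partrec_listMachine hL hk c
  prefixFree := by
    intro r r' hr hr' hrr
    obtain ⟨m, τ, hm⟩ := Nat.rfindOpt_dom.1 hr
    obtain ⟨m', τ', hm'⟩ := Nat.rfindOpt_dom.1 hr'
    obtain ⟨p, w, σ, rfl, hσ, hw, -⟩ := (exists_mem_listStep_iff hc).1 ⟨m, hm⟩
    obtain ⟨p', w', σ', rfl, hσ', hw', -⟩ := (exists_mem_listStep_iff hc).1 ⟨m', hm'⟩
    have hd := Part.dom_iff_mem.2 ⟨_, hσ⟩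
    have hd' := Part.dom_iff_mem.2 ⟨_, hσ'⟩
    have hp : p <+: p' ++ w' := (List.prefix_append _ _).trans hrr
    obtain rfl : p = p' := by
      rcases List.prefix_or_prefix_of_prefix hp (List.prefix_append _ _) with h | h
      · exact hU.prefixFree _ _ hd hd' h
      · exact (hU.prefixFree _ _ hd' hd h).symm
    obtain rfl := Part.mem_unique hσ hσ'
    exact hrr.eq_of_length (by simp [hw, hw'])

theorem mem_listMachine (hU : IsPrefixFreeMachine U)
    (hc : ∀ p, Code.eval c (Encodable.encode p) = (U p).map Encodable.encode)
    {p w σ τ : List Bool} (hσ : σ ∈ U p) (hw : w.length = k σ)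
    (hτ : (L σ)[(boolStrings (k σ)).idxOf w]? = some τ) : τ ∈ listMachine L k c (p ++ w) := by
  obtain ⟨m, hm⟩ := (exists_mem_listStep_iff hc).2 ⟨p, w, σ, rfl, hσ, hw, hτ⟩
  have hdom : (listMachine L k c (p ++ w)).Dom := Nat.rfindOpt_dom.2 ⟨m, τ, hm⟩
  obtain ⟨τ', hτ'⟩ := Part.dom_iff_mem.1 hdom
  -- The search may succeed first at another stage; prefix-freeness forces the same splitting.
  obtain ⟨p', w', σ', hr, hσ', hw', hτ₂⟩ :=
    (exists_mem_listStep_iff hc).1 (Nat.rfindOpt_spec hτ')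
  obtain rfl : p = p' := by
    rcases List.prefix_or_prefix_of_prefix (List.prefix_append p w)
      (hr ▸ List.prefix_append p' w') with h | h
    · exact hU.prefixFree _ _ (Part.dom_iff_mem.2 ⟨_, hσ⟩) (Part.dom_iff_mem.2 ⟨_, hσ'⟩) h
    · exact (hU.prefixFree _ _ (Part.dom_iff_mem.2 ⟨_, hσ'⟩) (Part.dom_iff_mem.2 ⟨_, hσ⟩) h).symm
  obtain rfl := List.append_cancel_left hr
  obtain rfl := Part.mem_unique hσ hσ'
  rw [hτ] at hτ₂
  exact Option.some.inj hτ₂ ▸ hτ'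

/-- If the members of a primitive recursive list `L σ` can be numbered by `k σ` bits, each of them
has complexity at most `K(σ) + k(σ) + O(1)`. -/
theorem IsOptimalPrefixFreeMachine.prefixComplexity_le_of_mem_list
    (hU : IsOptimalPrefixFreeMachine U) (hL : Primrec L) (hk : Primrec k) :
    ∃ c : ℕ, ∀ σ, (L σ).length ≤ 2 ^ k σ → ∀ τ ∈ L σ,
      prefixComplexity U τ ≤ prefixComplexity U σ + k σ + c := by
  obtain ⟨e, he⟩ := Code.exists_code.1 hU.partrec
  have he' : ∀ p, Code.eval e (Encodable.encode p) = (U p).map Encodable.encode := by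
    intro p
    rw [he]
    simp
  obtain ⟨c, hc⟩ := hU.optimal _
    (isPrefixFreeMachine_listMachine hU.toIsPrefixFreeMachine he' hL hk)
  refine ⟨c, fun σ hcard τ hτ => ?_⟩
  obtain ⟨p, hp, hpl⟩ := hU.exists_program σ
  obtain ⟨i, hi, hiτ⟩ := List.getElem_of_mem hτ
  have hi' : i < (boolStrings (k σ)).length := by
    rw [length_boolStrings]; exact hi.trans_le hcard
  have hw : ((boolStrings (k σ))[i]).length = k σ := mem_boolStrings.1 (List.getElem_mem hi')
  obtain ⟨q, hq, hql⟩ := hc (p ++ (boolStrings (k σ))[i]) τ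
    (mem_listMachine hU.toIsPrefixFreeMachine he' hp hw (by
      rw [(nodup_boolStrings _).idxOf_getElem i hi', List.getElem?_eq_getElem hi, hiτ]))
  have := prefixComplexity_le hq
  rw [List.length_append, hw, hpl] at hql
  omega

end Complexity

/-! ### Hamming balls -/

/-- The number of positions of `σ` at which `τ` has a different entry, or none. -/
def mismatches (σ τ : List Bool) : ℕ :=
  ((List.range σ.length).filterMap fun i => if σ[i]? = τ[i]? then none else some i).length

theorem primrec_mismatches : Primrec₂ mismatches := by
  refine Primrec.list_length.comp (Primrec.listFilterMap
    (Primrec.list_range.comp (Primrec.list_length.comp Primrec.fst)) ?_)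
  exact Primrec.ite (Primrec.eq.comp
    (Primrec.list_getElem?.comp (Primrec.fst.comp Primrec.fst) Primrec.snd)
    (Primrec.list_getElem?.comp (Primrec.snd.comp Primrec.fst) Primrec.snd))
    (Primrec.const none) (Primrec.option_some.comp Primrec.snd)

theorem mismatches_ofFn {n : ℕ} (σ τ : Fin n → Bool) :
    mismatches (List.ofFn σ) (List.ofFn τ) = hammingDist σ τ := by
  have h : (fun i : ℕ => if (List.ofFn σ)[i]? = (List.ofFn τ)[i]? then none else some i) =
      Option.guard fun i : ℕ => decide ((List.ofFn σ)[i]? ≠ (List.ofFn τ)[i]?) := by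
    funext i
    by_cases hi : (List.ofFn σ)[i]? = (List.ofFn τ)[i]? <;> simp [Option.guard, hi]
  rw [mismatches, h, List.filterMap_eq_filter, List.length_ofFn, ← List.map_coe_finRange_eq_range,
    List.filter_map, List.length_map, hammingDist]
  rw [← List.toFinset_card_of_nodup ((List.nodup_finRange n).filter _)]
  congr 1
  ext i
  simp

/-- The strings of the length of `σ` whose normalised Hamming distance from `σ` is at most `a / b`,
in the form of an integer inequality. -/
def ballList (a b : ℕ) (σ : List Bool) : List (List Bool) :=
  (boolStrings σ.length).filterMap fun τ =>
    if b * mismatches σ τ ≤ a * σ.length then some τ else none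

theorem primrec_ballList (a b : ℕ) : Primrec (ballList a b) := by
  refine Primrec.listFilterMap (primrec_boolStrings.comp Primrec.list_length) ?_
  exact Primrec.ite (Primrec.nat_le.comp
    (Primrec.nat_mul.comp (Primrec.const b) (primrec_mismatches.comp Primrec.fst Primrec.snd))
    (Primrec.nat_mul.comp (Primrec.const a) (Primrec.list_length.comp Primrec.fst)))
    (Primrec.option_some.comp Primrec.snd) (Primrec.const none)

theorem mem_ballList {a b : ℕ} {σ τ : List Bool} :
    τ ∈ ballList a b σ ↔ τ.length = σ.length ∧ b * mismatches σ τ ≤ a * σ.length := by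
  simp [ballList, mem_boolStrings]

theorem nodup_ballList (a b : ℕ) (σ : List Bool) : (ballList a b σ).Nodup := by
  refine (nodup_boolStrings _).filterMap fun s t u hs ht => ?_
  simp only [Option.mem_def] at hs ht
  split_ifs at hs ht
  simp_all

theorem length_ballList_le_two_pow (a b : ℕ) (σ : List Bool) :
    (ballList a b σ).length ≤ 2 ^ σ.length :=
  (List.length_filterMap_le _ _).trans (length_boolStrings _).le

theorem length_ballList_ofFn_le (a b : ℕ) {n : ℕ} (σ : Fin n → Bool) :
    (ballList a b (List.ofFn σ)).length ≤
      (Finset.univ.filter fun τ : Fin n → Bool => b * hammingDist σ τ ≤ a * n).card := by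
  classical
  rw [← List.toFinset_card_of_nodup (nodup_ballList a b _)]
  refine (Finset.card_le_card fun τ hτ => ?_).trans (Finset.card_image_le (f := List.ofFn))
  rw [List.mem_toFinset, mem_ballList, List.length_ofFn] at hτ
  obtain ⟨rfl, hτ⟩ := hτ
  have h : (List.ofFn fun i : Fin τ.length => τ[i]) = τ := List.ofFn_getElem
  refine Finset.mem_image.2 ⟨fun i => τ[i], ?_, h⟩
  rw [Finset.mem_filter, ← mismatches_ofFn]
  exact ⟨Finset.mem_univ _, by rw [h]; exact hτ⟩

theorem two_rpow_entropy_mul {q : ℝ} (h0 : 0 < q) (h1 : q < 1) (n : ℝ) :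
    (2 : ℝ) ^ (-(n * entropy q)) = q ^ (q * n) * (1 - q) ^ (n - q * n) := by
  have h2 : Real.log 2 ≠ 0 := (Real.log_pos one_lt_two).ne'
  rw [Real.rpow_def_of_pos two_pos, Real.rpow_def_of_pos h0,
    Real.rpow_def_of_pos (sub_pos.2 h1), ← Real.exp_add, entropy, Real.logb, Real.logb]
  congr 1
  field_simp

/-- The volume bound for Hamming balls: under independent bit flips of probability `q ≤ 1 / 2`,
every member of the ball of radius `q n` has probability at least `2 ^ (-n H(q))`. -/
theorem card_hammingBall_le {q : ℝ} (h0 : 0 < q) (h1 : q ≤ 1 / 2) {n : ℕ} (σ : Fin n → Bool) :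
    ((Finset.univ.filter fun τ : Fin n → Bool => (hammingDist σ τ : ℝ) ≤ q * n).card : ℝ) ≤
      2 ^ (n * entropy q) := by
  have hq : 0 < 1 - q := by linarith
  set w : (Fin n → Bool) → ℝ := fun τ => ∏ i, if σ i ≠ τ i then q else 1 - q
  have hw0 : ∀ τ, 0 ≤ w τ := fun τ => Finset.prod_nonneg fun i _ => by split_ifs <;> positivity
  have hsum : ∑ τ, w τ = 1 := by
    have := Fintype.prod_sum fun (i : Fin n) (b : Bool) => if σ i ≠ b then q else 1 - q
    rw [← this]
    refine Finset.prod_eq_one fun i _ => ?_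
    cases σ i <;> simp
  have hw : ∀ τ, w τ = q ^ (hammingDist σ τ : ℝ) * (1 - q) ^ ((n : ℝ) - hammingDist σ τ) := by
    intro τ
    have hcard := Finset.card_filter_add_card_filter_not (s := (Finset.univ : Finset (Fin n)))
      fun i => σ i ≠ τ i
    have hcard' : (n : ℝ) - hammingDist σ τ =
        ((Finset.univ.filter fun i => ¬ σ i ≠ τ i).card : ℕ) := by
      rw [sub_eq_iff_eq_add, hammingDist, add_comm]
      exact_mod_cast (by simpa using hcard.symm)
    rw [hcard', Real.rpow_natCast, Real.rpow_natCast]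
    simp only [w]
    rw [Finset.prod_ite, Finset.prod_const, Finset.prod_const]
    rfl
  have hle : ∀ τ ∈ Finset.univ.filter fun τ : Fin n → Bool => (hammingDist σ τ : ℝ) ≤ q * n,
      (2 : ℝ) ^ (-(n * entropy q)) ≤ w τ := by
    intro τ hτ
    have hd : (hammingDist σ τ : ℝ) ≤ q * n := (Finset.mem_filter.1 hτ).2
    rw [two_rpow_entropy_mul h0 (by linarith), hw]
    generalize ((hammingDist σ τ : ℕ) : ℝ) = d at hd ⊢
    calc q ^ (q * n) * (1 - q) ^ (n - q * n)
        = q ^ d * q ^ (q * n - d) * (1 - q) ^ (n - q * n) := by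
          rw [← Real.rpow_add h0]; ring_nf
      _ ≤ q ^ d * (1 - q) ^ (q * n - d) * (1 - q) ^ (n - q * n) := by
          gcongr
          linarith
      _ = q ^ d * (1 - q) ^ (n - d) := by
          rw [mul_assoc, ← Real.rpow_add hq]; ring_nf
  have := (Finset.card_nsmul_le_sum _ w _ hle).trans
    ((Finset.sum_le_sum_of_subset_of_nonneg (Finset.subset_univ _)
      fun τ _ _ => hw0 τ).trans hsum.le)
  rw [nsmul_eq_mul, Real.rpow_neg two_pos.le, ← div_eq_mul_inv] at this
  exact (div_le_one (by positivity)).1 this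

theorem length_ballList_le {a b a' b' : ℕ} (ha : 0 < a) (hb : 0 < b) (hb' : 0 < b')
    (h1 : (a / b : ℝ) ≤ 1 / 2) (hh : entropy (a / b) ≤ a' / b') {n : ℕ} (σ : Fin n → Bool) :
    (ballList a b (List.ofFn σ)).length ≤ 2 ^ (a' * n / b' + 1) := by
  have hb0 : (0 : ℝ) < b := by exact_mod_cast hb
  have hb0' : (0 : ℝ) < b' := by exact_mod_cast hb'
  have hq : (0 : ℝ) < a / b := div_pos (by exact_mod_cast ha) hb0
  have hiff : ∀ τ : Fin n → Bool,
      b * hammingDist σ τ ≤ a * n ↔ (hammingDist σ τ : ℝ) ≤ a / b * n := by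
    intro τ
    rw [div_mul_eq_mul_div, le_div_iff₀ hb0, mul_comm]
    exact_mod_cast Iff.rfl
  have hball := length_ballList_ofFn_le a b σ
  simp only [hiff] at hball
  have hexp : n * entropy (a / b) ≤ ((a' * n / b' + 1 : ℕ) : ℝ) := by
    have hlt : ((a' * n : ℕ) : ℝ) < b' * ((a' * n / b' + 1 : ℕ) : ℝ) := by
      exact_mod_cast Nat.lt_mul_div_succ (a' * n) hb'
    calc n * entropy (a / b) ≤ n * (a' / b') := by gcongr
      _ = ((a' * n : ℕ) : ℝ) / b' := by push_cast; ring
      _ ≤ _ := (div_le_iff₀ hb0').2 (by linarith)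
  have h2 := (Nat.cast_le (α := ℝ)).2 hball |>.trans ((card_hammingBall_le hq h1 σ).trans
    (Real.rpow_le_rpow_of_exponent_le one_le_two hexp))
  rw [Real.rpow_natCast] at h2
  exact_mod_cast h2

/-! ### Comparison of effective dimensions -/

section Dimension

open Filter Topology

variable {U : List Bool →. List Bool}

theorem isBoundedUnder_ge_strDim (U : List Bool →. List Bool) (X : ℕ → Bool) :
    IsBoundedUnder (· ≥ ·) atTop fun n : ℕ => strDim U (restrict X n) :=
  isBoundedUnder_of ⟨0, fun _ => div_nonneg (Nat.cast_nonneg _) (Nat.cast_nonneg _)⟩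

theorem IsOptimalPrefixFreeMachine.isBoundedUnder_le_strDim (hU : IsOptimalPrefixFreeMachine U)
    (X : ℕ → Bool) : IsBoundedUnder (· ≤ ·) atTop fun n : ℕ => strDim U (restrict X n) := by
  obtain ⟨c, hc⟩ := hU.exists_prefixComplexity_le
  refine isBoundedUnder_of ⟨2 + c, fun n => ?_⟩
  rcases n.eq_zero_or_pos with rfl | hn
  · simp only [strDim, Nat.cast_zero, div_zero]; positivity
  · have hn' : (1 : ℝ) ≤ n := by exact_mod_cast hn
    have h : (prefixComplexity U (List.ofFn (restrict X n)) : ℝ) ≤ 2 * n + c := by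
      exact_mod_cast (List.length_ofFn (f := restrict X n)) ▸ hc (List.ofFn (restrict X n))
    rw [strDim, div_le_iff₀ (by linarith)]
    nlinarith [Nat.cast_nonneg (α := ℝ) c]

/-- If the ball of radius `a / b` about every string of length `n` has at most
`2 ^ (⌊a' n / b'⌋ + 1)` members, and the prefixes of `Y` eventually lie in the balls about the
prefixes of `X`, then the dimension of `Y` exceeds that of `X` by at most `a' / b'`. -/
theorem IsOptimalPrefixFreeMachine.effDim_le_add (hU : IsOptimalPrefixFreeMachine U)
    {X Y : ℕ → Bool} {a b a' b' : ℕ} (hb : 0 < b)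
    (hcard : ∀ (n : ℕ) (σ : Fin n → Bool),
      (ballList a b (List.ofFn σ)).length ≤ 2 ^ (a' * n / b' + 1))
    (hXY : ∀ᶠ n : ℕ in atTop, strDist (restrict X n) (restrict Y n) ≤ a / b) :
    effDim U Y ≤ effDim U X + a' / b' := by
  have hk : Primrec fun σ : List Bool => a' * σ.length / b' + 1 :=
    Primrec.succ.comp (Primrec.nat_div.comp
      (Primrec.nat_mul.comp (Primrec.const a') Primrec.list_length) (Primrec.const b'))
  obtain ⟨c, hc⟩ := hU.prefixComplexity_le_of_mem_list (primrec_ballList a b) hk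
  refine le_of_forall_pos_le_add fun ε hε => ?_
  have hsmall : ∀ᶠ n : ℕ in atTop, ((c : ℝ) + 1) / n < ε :=
    (tendsto_const_div_atTop_nhds_zero_nat _).eventually_lt_const hε
  have hle : ∀ᶠ n : ℕ in atTop,
      strDim U (restrict Y n) ≤ strDim U (restrict X n) + (a' / b' + ε) := by
    filter_upwards [hXY, hsmall, eventually_gt_atTop 0] with n hd hs hn
    have hn0 : (0 : ℝ) < n := by exact_mod_cast hn
    have hb0 : (0 : ℝ) < b := by exact_mod_cast hb
    have hmem : List.ofFn (restrict Y n) ∈ ballList a b (List.ofFn (restrict X n)) := by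
      rw [mem_ballList, mismatches_ofFn, List.length_ofFn, List.length_ofFn]
      refine ⟨rfl, ?_⟩
      rw [strDist, div_le_div_iff₀ hn0 hb0, mul_comm] at hd
      exact_mod_cast hd
    have hK := hc (List.ofFn (restrict X n))
      (by rw [List.length_ofFn]; exact hcard n _) _ hmem
    rw [List.length_ofFn] at hK
    have hK' : (prefixComplexity U (List.ofFn (restrict Y n)) : ℝ) ≤
        prefixComplexity U (List.ofFn (restrict X n)) + a' * n / b' + (c + 1) := by
      have hdiv : ((a' * n / b' : ℕ) : ℝ) ≤ a' * n / b' := by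
        exact_mod_cast Nat.cast_div_le (α := ℝ) (m := a' * n) (n := b')
      have := (Nat.cast_le (α := ℝ)).2 hK
      push_cast at this hdiv
      linarith
    calc strDim U (restrict Y n)
        ≤ (prefixComplexity U (List.ofFn (restrict X n)) + a' * n / b' + (c + 1)) / n :=
          div_le_div_of_nonneg_right hK' hn0.le
      _ = strDim U (restrict X n) + (a' / b' + (c + 1) / n) := by
          rw [strDim]; field_simp; ring
      _ ≤ _ := by linarith
  calc effDim U Y
      ≤ liminf (fun n : ℕ => strDim U (restrict X n) + (a' / b' + ε)) atTop := by
        refine liminf_le_liminf hle (isBoundedUnder_ge_strDim U Y) ?_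
        obtain ⟨B, hB⟩ := hU.isBoundedUnder_le_strDim X
        refine IsBoundedUnder.isCoboundedUnder_ge ⟨B + (a' / b' + ε), ?_⟩
        rw [eventually_map] at hB ⊢
        filter_upwards [hB] with n hn
        linarith
    _ = effDim U X + a' / b' + ε := by
        rw [liminf_add_const _ _ _ (hU.isBoundedUnder_le_strDim X).isCoboundedUnder_ge
          (isBoundedUnder_ge_strDim U X), effDim, add_assoc]

theorem strDist_nonneg {n : ℕ} (σ τ : Fin n → Bool) : 0 ≤ strDist σ τ :=
  div_nonneg (Nat.cast_nonneg _) (Nat.cast_nonneg _)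

theorem strDist_le_one {n : ℕ} (σ τ : Fin n → Bool) : strDist σ τ ≤ 1 := by
  refine div_le_one_of_le₀ ?_ (Nat.cast_nonneg _)
  exact_mod_cast (hammingDist_le_card_fintype (x := σ) (y := τ)).trans (Fintype.card_fin n).le

theorem isBoundedUnder_le_strDist (X Y : ℕ → Bool) :
    IsBoundedUnder (· ≤ ·) atTop fun n : ℕ => strDist (restrict X n) (restrict Y n) :=
  isBoundedUnder_of ⟨1, fun _ => strDist_le_one _ _⟩

theorem besicovitchDist_nonneg (X Y : ℕ → Bool) : 0 ≤ besicovitchDist X Y :=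
  le_limsup_of_frequently_le (Frequently.of_forall fun _ => strDist_nonneg _ _)
    (isBoundedUnder_le_strDist X Y)

theorem besicovitchDist_comm (X Y : ℕ → Bool) : besicovitchDist X Y = besicovitchDist Y X := by
  simp only [besicovitchDist, strDist, hammingDist_comm]

theorem entropy_eq_binEntropy_div (p : ℝ) : entropy p = Real.binEntropy p / Real.log 2 := by
  rw [entropy, Real.binEntropy, Real.logb, Real.logb, Real.log_inv, Real.log_inv]
  ring

theorem entropy_half : entropy (1 / 2) = 1 := by
  rw [entropy_eq_binEntropy_div, one_div, Real.binEntropy_two_inv,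
    div_self (Real.log_pos one_lt_two).ne']

theorem continuous_entropy : Continuous entropy := by
  rw [show entropy = fun p => Real.binEntropy p / Real.log 2 from funext entropy_eq_binEntropy_div]
  exact Real.binEntropy_continuous.div_const _

theorem entropy_nonneg {p : ℝ} (h0 : 0 ≤ p) (h1 : p ≤ 1) : 0 ≤ entropy p := by
  rw [entropy_eq_binEntropy_div]
  exact div_nonneg (Real.binEntropy_nonneg h0 h1) (Real.log_pos one_lt_two).le

theorem exists_nat_div_btwn {x y : ℝ} (hx : 0 ≤ x) (hxy : x < y) :
    ∃ a b : ℕ, 0 < a ∧ 0 < b ∧ x < (a / b : ℝ) ∧ (a / b : ℝ) < y := by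
  obtain ⟨q, hxq, hqy⟩ := exists_rat_btwn hxy
  have hq : 0 < q := by exact_mod_cast hx.trans_lt hxq
  have hcast : ((q.num.toNat : ℝ) / q.den) = q := by
    have hnum : ((q.num.toNat : ℤ) : ℝ) = q.num :=
      congrArg _ (Int.toNat_of_nonneg (Rat.num_pos.2 hq).le)
    rw [Rat.cast_def, ← hnum, Int.cast_natCast]
  refine ⟨q.num.toNat, q.den, ?_, q.den_pos, ?_, ?_⟩
  · have := Rat.num_pos.2 hq
    omega
  · rwa [hcast]
  · rwa [hcast]

theorem IsOptimalPrefixFreeMachine.effDim_le_add_entropy (hU : IsOptimalPrefixFreeMachine U)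
    (X Y : ℕ → Bool) :
    effDim U Y ≤ effDim U X + entropy (min (besicovitchDist X Y) (1 / 2)) := by
  rcases le_or_gt (1 / 2) (besicovitchDist X Y) with hd | hd
  · -- Here the ball of radius `1`, that is, the set of all `2 ^ n` strings, is enough.
    have := hU.effDim_le_add (X := X) (Y := Y) (a := 1) (b := 1) (a' := 1) (b' := 1) one_pos
      (fun n σ => (length_ballList_le_two_pow 1 1 _).trans
        (Nat.pow_le_pow_right two_pos (by simp)))
      (Eventually.of_forall fun n => by simpa using strDist_le_one _ _)
    rw [min_eq_right hd, entropy_half]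
    simpa using this
  · rw [min_eq_left hd.le]
    have hd0 := besicovitchDist_nonneg X Y
    refine le_of_forall_pos_le_add fun ε hε => ?_
    have hev : ∀ᶠ q in 𝓝[>] besicovitchDist X Y, entropy q < entropy (besicovitchDist X Y) + ε :=
      (continuous_entropy.continuousAt.eventually_lt_const (by linarith)).filter_mono
        nhdsWithin_le_nhds
    obtain ⟨u, hu, hlt⟩ := (mem_nhdsGT_iff_exists_Ioo_subset' hd).1 hev
    obtain ⟨a, b, ha, hb, hda, hab⟩ := exists_nat_div_btwn hd0 (lt_min hu hd)
    have hH : entropy (a / b) < entropy (besicovitchDist X Y) + ε :=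
      hlt ⟨hda, hab.trans_le (min_le_left _ _)⟩
    have hhalf : (a / b : ℝ) ≤ 1 / 2 := (hab.trans_le (min_le_right _ _)).le
    obtain ⟨a', b', -, hb', hHa, hab'⟩ :=
      exists_nat_div_btwn (entropy_nonneg (hd0.trans hda.le) (by linarith)) hH
    have hXY : ∀ᶠ n : ℕ in atTop, strDist (restrict X n) (restrict Y n) ≤ a / b :=
      (eventually_lt_of_limsup_lt hda (isBoundedUnder_le_strDist X Y)).mono fun _ h => h.le
    have := hU.effDim_le_add hb
      (fun n σ => length_ballList_le ha hb hb' hhalf hHa.le σ) hXY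
    linarith

end Dimension

end EffectiveDimension

theorem mainTheorem6 (U : List Bool →. List Bool)
    (hU : EffectiveDimension.IsOptimalPrefixFreeMachine U) (X Y : ℕ → Bool) :
    |EffectiveDimension.effDim U Y - EffectiveDimension.effDim U X| ≤
      EffectiveDimension.entropy (min (EffectiveDimension.besicovitchDist X Y) (1 / 2)) := by
  have h₁ := hU.effDim_le_add_entropy X Y
  have h₂ := hU.effDim_le_add_entropy Y X
  rw [EffectiveDimension.besicovitchDist_comm Y X] at h₂
  exact abs_le.2 ⟨by linarith, by linarith⟩
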